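/- Let $G$ be a virtually abelian group (that is, $G$ has an abelian subgroup of finite index), let $S\subseteq G$ be a finite set that generates $G$ as a monoid, and let $\omega\colon S\to\{1,2,3,\ldots\}$ be any function assigning a positive integer weight to each generator. The weight of a word $s_1s_2\cdots s_k$ over $S$ is $\omega(s_1)+\cdots+\omega(s_k)$ (the empty word has weight $0$), the weight of an element $g\in G$ is the minimal weight of a word over $S$ representing $g$, and the weight of a conjugacy class is the minimal weight of its elements. For $n\ge 0$ let $c(n)$ be the number of conjugacy classes of $G$ of weight $n$ (a finite number). Then the weighted conjugacy growth series $$\sum_{n=0}^{\infty} c(n)z^n$$ is rational: there are polynomials $p,q$ with integer coefficients, $q\neq 0$, such that the series equals $p(z)/q(z)$. -/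

import Mathlib

/-- A group is virtually abelian if it has an abelian subgroup of finite index. -/
def IsVirtuallyAbelian (G : Type*) [Group G] : Prop :=
  ∃ A : Subgroup G, IsMulCommutative A ∧ A.FiniteIndex

namespace WeightedGrowth

/-- The element of `G` represented by a word over `S`. Words use the letters of `S` only,
not their formal inverses. -/
def wordEval {G : Type*} [Group G] {S : Finset G} (w : List S) : G :=
  (w.map (fun s : S => (s : G))).prod

/-- The weight of a word: the sum of the weights of its letters. -/
def wordWeight {G : Type*} {S : Finset G} (ω : S → ℕ) (w : List S) : ℕ :=
  (w.map ω).sum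

/-- The weight of a group element: the minimal weight of a word over `S` representing it. -/
noncomputable def elementWeight {G : Type*} [Group G] {S : Finset G} (ω : S → ℕ) (g : G) : ℕ :=
  sInf {n : ℕ | ∃ w : List S, wordEval w = g ∧ wordWeight ω w = n}

/-- The weight of a conjugacy class: the minimal weight of its elements. -/
noncomputable def classWeight {G : Type*} [Group G] {S : Finset G} (ω : S → ℕ)
    (c : ConjClasses G) : ℕ :=
  sInf (elementWeight ω '' c.carrier)

/-- The weighted conjugacy growth function: the number of conjugacy classes of weight `n`. -/
noncomputable def conjGrowth {G : Type*} [Group G] {S : Finset G} (ω : S → ℕ) (n : ℕ) : ℕ :=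
  {c : ConjClasses G | classWeight ω c = n}.ncard

/-- The weighted conjugacy growth series. -/
noncomputable def conjGrowthSeries {G : Type*} [Group G] {S : Finset G} (ω : S → ℕ) :
    PowerSeries ℤ :=
  PowerSeries.mk fun n => (conjGrowth ω n : ℤ)

/-- An integral power series is rational if it is a quotient `p / q` of polynomials with
integer coefficients, `q ≠ 0`. -/
def IsRationalSeries (f : PowerSeries ℤ) : Prop :=
  ∃ p q : Polynomial ℤ, q ≠ 0 ∧ (q : PowerSeries ℤ) * f = (p : PowerSeries ℤ)

theorem exists_wordEval_eq {G : Type*} [Group G] {S : Finset G}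
    (hS : Submonoid.closure (S : Set G) = ⊤) (g : G) : ∃ w : List S, wordEval w = g := by
  have hg : g ∈ Submonoid.closure (S : Set G) := by rw [hS]; trivial
  induction hg using Submonoid.closure_induction with
  | mem x hx => exact ⟨[⟨x, hx⟩], by simp [wordEval]⟩
  | one => exact ⟨[], by simp [wordEval]⟩
  | mul x y _ _ ihx ihy =>
    obtain ⟨u, rfl⟩ := ihx
    obtain ⟨v, rfl⟩ := ihy
    exact ⟨u ++ v, by simp [wordEval]⟩

theorem exists_word_classWeight {G : Type*} [Group G] {S : Finset G}
    (hS : Submonoid.closure (S : Set G) = ⊤) (ω : S → ℕ) (c : ConjClasses G) :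
    ∃ w : List S, ConjClasses.mk (wordEval w) = c ∧ wordWeight ω w = classWeight ω c := by
  have hne : (elementWeight ω '' c.carrier).Nonempty := by
    obtain ⟨g, rfl⟩ := ConjClasses.exists_rep c
    exact ⟨_, g, ConjClasses.mem_carrier_mk, rfl⟩
  obtain ⟨g, hg, hgw⟩ := Nat.sInf_mem hne
  obtain ⟨v, hv⟩ := exists_wordEval_eq hS g
  obtain ⟨w, hw, hww⟩ := Nat.sInf_mem
    (s := {n : ℕ | ∃ w : List S, wordEval w = g ∧ wordWeight ω w = n}) ⟨_, v, hv, rfl⟩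
  refine ⟨w, ?_, hww.trans hgw⟩
  rw [hw]
  exact ConjClasses.mem_carrier_iff_mk_eq.1 hg

theorem length_le_wordWeight {G : Type*} {S : Finset G} (ω : S → ℕ) (hω : ∀ s, 0 < ω s)
    (w : List S) : w.length ≤ wordWeight ω w := by
  induction w with
  | nil => simp
  | cons a l ih =>
    have h := hω a
    simp only [wordWeight, List.map_cons, List.sum_cons, List.length_cons] at ih ⊢
    omega

/-- The sets counted by `conjGrowth` are finite, so that `Set.ncard` is their true size. -/
theorem finite_classWeight_eq {G : Type*} [Group G] {S : Finset G}
    (hS : Submonoid.closure (S : Set G) = ⊤) (ω : S → ℕ) (hω : ∀ s, 0 < ω s) (n : ℕ) :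
    {c : ConjClasses G | classWeight ω c = n}.Finite := by
  refine ((List.finite_length_le S n).image
    (fun w => ConjClasses.mk (wordEval w))).subset ?_
  intro c hc
  obtain ⟨w, hw, hww⟩ := exists_word_classWeight hS ω c
  refine ⟨w, ?_, hw⟩
  have h := length_le_wordWeight ω hω w
  have hc' : classWeight ω c = n := hc
  show w.length ≤ n
  omega

end WeightedGrowth

/-!
Let `A` be an abelian normal subgroup of finite index. Reading a word moves an automaton on the
finite group `G ⧸ A`, and the number of times its run uses each transition determines the final
coset, the weight of the word, and (linearly, through Schreier generators) its value in `G`. By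
Kleene's theorem the transition counts of all words form a semilinear set. Two elements `a * t` and
`a' * t'` with `a, a' ∈ A` are conjugate by an element of a fixed coset of `A` if and only if `a`
and `a'` satisfy a linear equation in a quotient of `A`, so that conjugacy is a semilinear relation
between transition counts. The least transition count of each conjugacy class, for a semilinear
well-order refining the weight, then ranges over a semilinear set. Finally, a semilinear set is a
union of injective linear images of sets of tuples closed under `x + y - z`; these are stable under
intersection and have rational generating functions, and inclusion–exclusion applies.
-/

namespace WeightedGrowth

section RationalSeries

theorem isRationalSeries_coe (p : Polynomial ℤ) : IsRationalSeries (p : PowerSeries ℤ) :=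
  ⟨p, 1, one_ne_zero, by simp⟩

variable {f g : PowerSeries ℤ}

theorem IsRationalSeries.add (hf : IsRationalSeries f) (hg : IsRationalSeries g) :
    IsRationalSeries (f + g) := by
  obtain ⟨p, q, hq, hp⟩ := hf
  obtain ⟨p', q', hq', hp'⟩ := hg
  refine ⟨p * q' + p' * q, q * q', mul_ne_zero hq hq', ?_⟩
  simp only [Polynomial.coe_mul, Polynomial.coe_add, ← hp, ← hp']
  ring

theorem IsRationalSeries.sub (hf : IsRationalSeries f) (hg : IsRationalSeries g) :
    IsRationalSeries (f - g) := by
  obtain ⟨p, q, hq, hp⟩ := hf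
  obtain ⟨p', q', hq', hp'⟩ := hg
  refine ⟨p * q' - p' * q, q * q', mul_ne_zero hq hq', ?_⟩
  simp only [Polynomial.coe_mul, Polynomial.coe_sub, ← hp, ← hp']
  ring

theorem IsRationalSeries.of_coe_mul {p : Polynomial ℤ} (hp : p ≠ 0)
    (hf : IsRationalSeries ((p : PowerSeries ℤ) * f)) : IsRationalSeries f := by
  obtain ⟨p', q, hq, h⟩ := hf
  exact ⟨p', q * p, mul_ne_zero hq hp, by rw [Polynomial.coe_mul, mul_assoc, h]⟩

end RationalSeries

section Counting

open PowerSeries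

variable {α β : Type*}

/-- A set has finite fibres for a weight if it has finitely many elements of each weight. -/
def HasFiniteFibers (w : α → ℕ) (s : Set α) : Prop :=
  ∀ n, (s ∩ w ⁻¹' {n}).Finite

/-- The generating function counting the elements of a set by weight. It is meaningful for sets
with finite fibres only, since `Set.ncard` of an infinite set is `0`. -/
noncomputable def countSeries (w : α → ℕ) (s : Set α) : PowerSeries ℤ :=
  mk fun n => ((s ∩ w ⁻¹' {n}).ncard : ℤ)

theorem HasFiniteFibers.mono {w : α → ℕ} {s t : Set α} (ht : HasFiniteFibers w t) (hst : s ⊆ t) :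
    HasFiniteFibers w s :=
  fun n => (ht n).subset (Set.inter_subset_inter_left _ hst)

theorem hasFiniteFibers_image {w : β → ℕ} {g : α → β} {s : Set α} (hg : Set.InjOn g s) :
    HasFiniteFibers w (g '' s) ↔ HasFiniteFibers (w ∘ g) s :=
  forall_congr' fun n => by
    rw [← Set.image_inter_preimage, Set.finite_image_iff (hg.mono Set.inter_subset_left),
      Set.preimage_comp]

theorem countSeries_image {w : β → ℕ} {g : α → β} {s : Set α} (hg : Set.InjOn g s) :
    countSeries w (g '' s) = countSeries (w ∘ g) s := by
  ext n
  rw [countSeries, countSeries, coeff_mk, coeff_mk, ← Set.image_inter_preimage,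
    (hg.mono Set.inter_subset_left).ncard_image, Set.preimage_comp]

theorem countSeries_union_add_inter {w : α → ℕ} {s t : Set α} (h : HasFiniteFibers w (s ∪ t)) :
    countSeries w (s ∪ t) + countSeries w (s ∩ t) = countSeries w s + countSeries w t := by
  ext n
  simp only [countSeries, map_add, coeff_mk]
  rw [Set.union_inter_distrib_right, Set.inter_inter_distrib_right]
  exact_mod_cast Set.ncard_union_add_ncard_inter _ _ (h.mono Set.subset_union_left n)
    (h.mono Set.subset_union_right n)

theorem countSeries_const_add (w : α → ℕ) (s : Set α) (c : ℕ) :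
    countSeries (fun x => c + w x) s = X ^ c * countSeries w s := by
  ext n
  rw [coeff_X_pow_mul']
  simp only [countSeries, coeff_mk]
  split_ifs with hcn
  · congr! 3
    ext x
    simp only [Set.mem_preimage, Set.mem_singleton_iff]
    omega
  · have : (fun x => c + w x) ⁻¹' {n} = ∅ := Set.eq_empty_of_forall_notMem fun x hx =>
      hcn ((Nat.le_add_right c (w x)).trans_eq hx)
    simp [this]

theorem isRationalSeries_countSeries_of_finite (w : α → ℕ) {s : Set α} (hs : s.Finite) :
    IsRationalSeries (countSeries w s) := by
  classical
  lift s to Finset α using hs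
  convert isRationalSeries_coe (∑ x ∈ s, Polynomial.X ^ w x)
  ext n
  have hfiber : (s : Set α) ∩ w ⁻¹' {n} = (s.filter fun x => n = w x : Finset α) := by
    ext x
    simp [eq_comm]
  rw [countSeries, coeff_mk, hfiber, Set.ncard_coe_finset]
  simp [Polynomial.coeff_X_pow]

theorem isRationalSeries_countSeries_biUnion {ι : Type*} {w : α → ℕ} {P : Set α → Prop}
    (hinter : ∀ s t, P s → P t → P (s ∩ t))
    (hP : ∀ s, P s → HasFiniteFibers w s → IsRationalSeries (countSeries w s))
    (F : Finset ι) (f : ι → Set α) (hf : ∀ i ∈ F, P (f i))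
    (hfin : HasFiniteFibers w (⋃ i ∈ F, f i)) :
    IsRationalSeries (countSeries w (⋃ i ∈ F, f i)) := by
  classical
  induction F using Finset.induction_on generalizing f with
  | empty => simpa using isRationalSeries_countSeries_of_finite w Set.finite_empty
  | insert i F _ ih =>
    rw [Finset.forall_mem_insert] at hf
    rw [Finset.set_biUnion_insert] at hfin ⊢
    have hfi := hfin.mono Set.subset_union_left
    have hunion := ih f hf.2 (hfin.mono Set.subset_union_right)
    have hinter_union : IsRationalSeries (countSeries w (f i ∩ ⋃ j ∈ F, f j)) := by
      have hfin' := hfi.mono (Set.inter_subset_left (t := ⋃ j ∈ F, f j))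
      simp only [Set.inter_iUnion] at hfin' ⊢
      exact ih _ (fun j hj => hinter _ _ hf.1 (hf.2 j hj)) hfin'
    rw [eq_sub_of_add_eq (countSeries_union_add_inter hfin)]
    exact ((hP _ hf.1 hfi).add hunion).sub hinter_union

end Counting

section ParallelogramClosed

/-- A set `s` such that `x + y - z ∈ s` whenever `x, y, z ∈ s` and the difference exists.
Solution sets of linear equations have this property. -/
def IsParallelogramClosed {M : Type*} [Add M] (s : Set M) : Prop :=
  ∀ ⦃x y z v : M⦄, x ∈ s → y ∈ s → z ∈ s → x + y = z + v → v ∈ s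

theorem IsParallelogramClosed.inter {M : Type*} [Add M] {s t : Set M}
    (hs : IsParallelogramClosed s) (ht : IsParallelogramClosed t) :
    IsParallelogramClosed (s ∩ t) :=
  fun _ _ _ _ hx hy hz h => ⟨hs hx.1 hy.1 hz.1 h, ht hx.2 hy.2 hz.2 h⟩

theorem IsParallelogramClosed.preimage {M N F : Type*} [Add M] [Add N] [FunLike F M N]
    [AddHomClass F M N] {s : Set N} (hs : IsParallelogramClosed s) (f : F) :
    IsParallelogramClosed (f ⁻¹' s) :=
  fun _ _ _ _ hx hy hz h => hs hx hy hz (by rw [← map_add, h, map_add])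

theorem isParallelogramClosed_setOf_eq {M N F : Type*} [Add M] [Add N] [IsLeftCancelAdd N]
    [FunLike F M N] [AddHomClass F M N] (f g : F) : IsParallelogramClosed {x | f x = g x} := by
  intro x y z v hx hy hz h
  simp only [Set.mem_ofPred_eq] at *
  refine add_left_cancel (a := f z) ?_
  calc f z + f v = f x + f y := by rw [← map_add, ← h, map_add]
    _ = g x + g y := by rw [hx, hy]
    _ = g z + g v := by rw [← map_add, h, map_add]
    _ = f z + g v := by rw [hz]

theorem isParallelogramClosed_singleton {M : Type*} [Add M] [IsLeftCancelAdd M] (a : M) :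
    IsParallelogramClosed {a} := by
  rintro _ _ _ v rfl rfl rfl h
  exact (add_left_cancel h).symm

variable {ι : Type*}

theorem IsParallelogramClosed.add_mem_iff {M : Type*} [AddCommSemigroup M] {s : Set M}
    (hs : IsParallelogramClosed s) {x u : M} (hx : x ∈ s) (hxu : x + u ∈ s) (y : M) :
    u + y ∈ s ↔ y ∈ s :=
  ⟨fun huy => hs hx huy hxu (add_assoc x u y).symm, fun hy => hs hxu hy hx (add_assoc x u y)⟩

/-- Dickson's lemma. -/
theorem finite_or_exists_add_mem [Finite ι] (s : Set (ι → ℕ)) :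
    s.Finite ∨ ∃ x ∈ s, ∃ u ≠ 0, x + u ∈ s := by
  by_contra! ⟨hinf, hs⟩
  refine hinf (WellQuasiOrderedLE.finite_of_isAntichain fun x hx y hy hxy hle => ?_)
  obtain ⟨u, rfl⟩ := exists_add_of_le hle
  exact hs x hx u (by rintro rfl; simp at hxy) hy

theorem map_ne_zero_of_add_mem_iff {M : Type*} [AddCancelMonoid M] [IsAddTorsionFree M]
    {w : M →+ ℕ} {s : Set M} (hfin : HasFiniteFibers w s) (hne : s.Nonempty) {u : M} (hu : u ≠ 0)
    (hs : ∀ y, u + y ∈ s ↔ y ∈ s) : w u ≠ 0 := by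
  intro hw
  obtain ⟨x, hx⟩ := hne
  have hmem (n : ℕ) : n • u + x ∈ s ∩ w ⁻¹' {w x} := by
    refine ⟨?_, by simp [hw]⟩
    induction n with
    | zero => simpa using hx
    | succ n ih => rwa [succ_nsmul', add_assoc, hs]
  have hinj : Function.Injective fun n : ℕ => n • u + x :=
    (add_left_injective x).comp <| injective_nsmul_iff_not_isOfFinAddOrder.2 <|
      (isOfFinAddOrder_iff_eq_zero u).not.2 hu
  exact Set.infinite_of_injective_forall_mem hinj hmem (hfin (w x))

theorem one_sub_X_pow_mul_countSeries {M : Type*} [AddCommMonoid M] [IsLeftCancelAdd M]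
    [PartialOrder M] [CanonicallyOrderedAdd M] {w : M →+ ℕ} {s : Set M}
    (hfin : HasFiniteFibers w s) {u : M} (hs : ∀ y, u + y ∈ s ↔ y ∈ s) :
    (1 - PowerSeries.X ^ w u) * countSeries w s = countSeries w {y ∈ s | ¬ u ≤ y} := by
  have hle : {y ∈ s | u ≤ y} = (u + ·) '' s := by
    ext y
    constructor
    · rintro ⟨hy, huy⟩
      obtain ⟨z, rfl⟩ := exists_add_of_le huy
      exact ⟨z, (hs z).1 hy, rfl⟩
    · rintro ⟨z, hz, rfl⟩
      exact ⟨(hs z).2 hz, le_self_add⟩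
  have hunion : {y ∈ s | u ≤ y} ∪ {y ∈ s | ¬ u ≤ y} = s := by
    ext y
    simp [← and_or_left, em]
  have hinter : {y ∈ s | u ≤ y} ∩ {y ∈ s | ¬ u ≤ y} = ∅ := by
    ext y
    simp +contextual
  have hcount := countSeries_union_add_inter (hunion.symm ▸ hfin)
  rw [hunion, hinter, hle, countSeries_image (add_right_injective u).injOn] at hcount
  have hshift : countSeries (w ∘ (u + ·)) s = PowerSeries.X ^ w u * countSeries w s := by
    simp only [Function.comp_def, map_add, countSeries_const_add]
  have hempty : countSeries w ∅ = 0 := by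
    ext
    simp [countSeries]
  rw [sub_mul, one_mul, ← hshift, sub_eq_iff_eq_add', ← hcount, hempty, add_zero]

theorem setOf_not_le_eq_biUnion [Fintype ι] (s : Set (ι → ℕ)) (u : ι → ℕ) :
    {y ∈ s | ¬ u ≤ y} =
      ⋃ p ∈ Finset.univ.sigma fun i => Finset.range (u i), s ∩ {y | y p.1 = p.2} := by
  ext y
  simp [Pi.le_def]

/-- The coordinates outside `t` are constant on `s`. The number of remaining coordinates drives the
induction that computes generating functions of sets of tuples. -/
def IsConstOutside (t : Finset ι) (s : Set (ι → ℕ)) : Prop :=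
  ∀ i ∉ t, (Function.eval i '' s).Subsingleton

theorem IsConstOutside.mono {t : Finset ι} {s s' : Set (ι → ℕ)} (hs : IsConstOutside t s)
    (hss' : s' ⊆ s) : IsConstOutside t s' :=
  fun i hi => (hs i hi).anti (Set.image_mono hss')

theorem IsConstOutside.mem_of_add_mem {t : Finset ι} {s : Set (ι → ℕ)} (hs : IsConstOutside t s)
    {x u : ι → ℕ} (hx : x ∈ s) (hxu : x + u ∈ s) {i : ι} (hi : u i ≠ 0) : i ∈ t := by
  by_contra hit
  exact hi (by simpa using hs i hit ⟨_, hxu, rfl⟩ ⟨_, hx, rfl⟩)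

theorem IsConstOutside.inter_apply_eq [DecidableEq ι] {t : Finset ι} {s : Set (ι → ℕ)}
    (hs : IsConstOutside t s) (i : ι) (j : ℕ) :
    IsConstOutside (t.erase i) (s ∩ {y | y i = j}) := by
  intro k hk
  by_cases hki : k = i
  · subst hki
    rintro _ ⟨y, hy, rfl⟩ _ ⟨z, hz, rfl⟩
    exact hy.2.trans hz.2.symm
  · exact hs.mono Set.inter_subset_left k fun hkt => hk (Finset.mem_erase.2 ⟨hki, hkt⟩)

theorem IsParallelogramClosed.isRationalSeries_countSeries [Finite ι] {w : (ι → ℕ) →+ ℕ}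
    {s : Set (ι → ℕ)} (hs : IsParallelogramClosed s) (hfin : HasFiniteFibers w s) :
    IsRationalSeries (countSeries w s) := by
  classical
  have := Fintype.ofFinite ι
  obtain ⟨t, ht⟩ : ∃ t : Finset ι, IsConstOutside t s := ⟨Finset.univ, by simp [IsConstOutside]⟩
  induction t using Finset.strongInduction generalizing s with | _ t ih
  obtain hsfin | ⟨x, hx, u, hu, hxu⟩ := finite_or_exists_add_mem s
  · exact isRationalSeries_countSeries_of_finite w hsfin
  have hstable := hs.add_mem_iff hx hxu
  have hwu := map_ne_zero_of_add_mem_iff hfin ⟨x, hx⟩ hu hstable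
  refine .of_coe_mul (p := 1 - Polynomial.X ^ w u) ?_ ?_
  · intro h
    simpa [hwu] using congrArg (Polynomial.eval 0) h
  have hfin' : HasFiniteFibers w {y ∈ s | ¬ u ≤ y} := hfin.mono (Set.sep_subset _ _)
  rw [Polynomial.coe_sub, Polynomial.coe_one, Polynomial.coe_pow, Polynomial.coe_X,
    one_sub_X_pow_mul_countSeries hfin hstable]
  rw [setOf_not_le_eq_biUnion] at hfin' ⊢
  refine isRationalSeries_countSeries_biUnion
    (P := fun s' => IsParallelogramClosed s' ∧ ∃ i ∈ t, IsConstOutside (t.erase i) s')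
    ?_ ?_ _ _ ?_ hfin'
  · rintro s₁ s₂ ⟨h₁, i, hi, hi₁⟩ ⟨h₂, -⟩
    exact ⟨h₁.inter h₂, i, hi, hi₁.mono Set.inter_subset_left⟩
  · rintro s' ⟨hs', i, hi, hi'⟩ hfin'
    exact ih _ (Finset.erase_ssubset hi) hs' hfin' hi'
  · rintro ⟨i, j⟩ hij
    rw [Finset.mem_sigma, Finset.mem_range] at hij
    exact ⟨hs.inter ((isParallelogramClosed_singleton j).preimage (Pi.evalAddHom _ i)), i,
      ht.mem_of_add_mem hx hxu (Nat.ne_zero_of_lt hij.2), ht.inter_apply_eq i j⟩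

end ParallelogramClosed

section Unambiguous

universe u

/-- Injective linear images of parallelogram-closed sets of tuples of natural numbers. The tuples
have an arbitrary finite index type in the universe of `M`, which makes gluing index types
painless. -/
def IsUnambiguous {M : Type u} [AddCommMonoid M] (X : Set M) : Prop :=
  ∃ (ι : Type u) (_ : Finite ι) (s : Set (ι → ℕ)) (φ : (ι → ℕ) →+ M),
    IsParallelogramClosed s ∧ Set.InjOn φ s ∧ X = φ '' s

theorem IsUnambiguous.inter {M : Type u} [AddCancelCommMonoid M] {X Y : Set M}
    (hX : IsUnambiguous X) (hY : IsUnambiguous Y) : IsUnambiguous (X ∩ Y) := by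
  obtain ⟨ι, _, s, φ, hs, hφ, rfl⟩ := hX
  obtain ⟨κ, _, t, ψ, ht, hψ, rfl⟩ := hY
  let fstHom : (ι ⊕ κ → ℕ) →+ (ι → ℕ) :=
    (LinearMap.funLeft ℕ ℕ Sum.inl).toAddMonoidHom
  let sndHom : (ι ⊕ κ → ℕ) →+ (κ → ℕ) :=
    (LinearMap.funLeft ℕ ℕ Sum.inr).toAddMonoidHom
  refine ⟨ι ⊕ κ, inferInstance,
    fstHom ⁻¹' s ∩ (sndHom ⁻¹' t ∩ {z | φ.comp fstHom z = ψ.comp sndHom z}), φ.comp fstHom,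
    (hs.preimage fstHom).inter ((ht.preimage sndHom).inter (isParallelogramClosed_setOf_eq _ _)),
    ?_, ?_⟩
  · rintro z ⟨hz₁, hz₂, hz⟩ z' ⟨hz₁', hz₂', hz'⟩ h
    have hfst : fstHom z = fstHom z' := hφ hz₁ hz₁' h
    have hsnd : sndHom z = sndHom z' := hψ hz₂ hz₂' (hz.symm.trans (h.trans hz'))
    ext (i | i)
    exacts [congrFun hfst i, congrFun hsnd i]
  · ext m
    constructor
    · rintro ⟨⟨x, hx, rfl⟩, y, hy, h⟩
      exact ⟨Sum.elim x y, ⟨hx, hy, h.symm⟩, rfl⟩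
    · rintro ⟨z, ⟨hz₁, hz₂, hz⟩, rfl⟩
      exact ⟨⟨fstHom z, hz₁, rfl⟩, sndHom z, hz₂, hz.symm⟩

theorem range_linearCombination_nat {M : Type*} [AddCommMonoid M] (t : Finset M) :
    Set.range (Fintype.linearCombination ℕ (Subtype.val : t → M)) =
      AddSubmonoid.closure (t : Set M) := by
  rw [← LinearMap.coe_range, Fintype.range_linearCombination, Subtype.range_coe_subtype,
    ← Submodule.coe_toAddSubmonoid, Submodule.span_nat_eq_addSubmonoidClosure]
  rfl

theorem isUnambiguous_of_isProperLinearSet {M : Type u} [AddCancelCommMonoid M] {X : Set M}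
    (hX : IsProperLinearSet X) : IsUnambiguous X := by
  obtain ⟨a, t, ht, rfl⟩ := isProperLinearSet_iff.1 hX
  let comb : (t → ℕ) →ₗ[ℕ] M := Fintype.linearCombination ℕ (Subtype.val : t → M)
  have hcomb : Function.Injective comb := LinearIndependent.fintypeLinearCombination_injective ht
  -- The translation by `a` is the effect of an additional coordinate that is required to be `1`.
  let evalNone : (Option t → ℕ) →+ ℕ := Pi.evalAddMonoidHom (fun _ => ℕ) none
  let φ : (Option t → ℕ) →+ M := (multiplesHom M a).comp evalNone +
    (comb.comp (LinearMap.funLeft ℕ ℕ some)).toAddMonoidHom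
  have hφ (x : Option t → ℕ) (hx : x none = 1) : φ x = a + comb (x ∘ some) := by
    change x none • a + comb (x ∘ some) = _
    rw [hx, one_nsmul]
  refine ⟨Option t, inferInstance, evalNone ⁻¹' {1}, φ,
    (isParallelogramClosed_singleton 1).preimage evalNone, ?_, ?_⟩
  · intro x hx y hy h
    rw [hφ x hx, hφ y hy] at h
    have hsome : x ∘ some = y ∘ some := hcomb (add_left_cancel h)
    ext (_ | i)
    exacts [hx.trans hy.symm, congrFun hsome i]
  · rw [← range_linearCombination_nat]
    ext m
    constructor
    · rintro ⟨_, ⟨y, rfl⟩, rfl⟩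
      exact ⟨fun i => i.elim 1 y, rfl, hφ _ rfl⟩
    · rintro ⟨x, hx, rfl⟩
      exact ⟨_, ⟨x ∘ some, rfl⟩, (hφ x hx).symm⟩

theorem IsUnambiguous.isRationalSeries_countSeries {M : Type u} [AddCommMonoid M] {X : Set M}
    (hX : IsUnambiguous X) {w : M →+ ℕ} (hfin : HasFiniteFibers w X) :
    IsRationalSeries (countSeries w X) := by
  obtain ⟨ι, _, s, φ, hs, hφ, rfl⟩ := hX
  rw [countSeries_image hφ]
  exact hs.isRationalSeries_countSeries (w := w.comp φ) ((hasFiniteFibers_image hφ).1 hfin)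

theorem isRationalSeries_countSeries_of_isSemilinearSet {M : Type*} [AddCancelCommMonoid M]
    {X : Set M} (hX : IsSemilinearSet X) {w : M →+ ℕ} (hfin : HasFiniteFibers w X) :
    IsRationalSeries (countSeries w X) := by
  obtain ⟨F, hF, rfl⟩ := isProperSemilinearSet_iff.1 hX.isProperSemilinearSet
  rw [Set.sUnion_eq_biUnion] at hfin ⊢
  exact isRationalSeries_countSeries_biUnion (fun _ _ => IsUnambiguous.inter)
    (fun _ hX hfin => hX.isRationalSeries_countSeries hfin) F id
    (fun X hX => isUnambiguous_of_isProperLinearSet (hF X hX)) hfin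

end Unambiguous

section MinimalRepresentatives

variable {κ : Type*}

theorem isSemilinearSet_setOf_eq {M N : Type*} [AddCommMonoid M] [AddMonoid.FG M]
    [AddCancelCommMonoid N] (f g : M →+ N) : IsSemilinearSet {x | f x = g x} := by
  simpa only [zero_add] using isSemilinearSet_setOfPred_eq 0 0 f g

theorem isSemilinearSet_setOf_lt {M : Type*} [AddCommMonoid M] [AddMonoid.FG M] (f g : M →+ ℕ) :
    IsSemilinearSet {x | f x < g x} := by
  have hgraph : IsSemilinearSet {z : M × ℕ | 1 + f.coprod (.id ℕ) z =
      0 + (g.comp (.fst M ℕ)) z} := isSemilinearSet_setOfPred_eq _ _ _ _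
  convert hgraph.image (AddMonoidHom.fst M ℕ)
  ext x
  simp only [Nat.lt_iff_add_one_le, le_iff_exists_add, Set.mem_image, Prod.exists]
  simp [add_comm, add_left_comm, eq_comm]

theorem isSemilinearSet_setOf_toLex_lt [Finite κ] [LinearOrder κ] {M : Type*} [AddCommMonoid M]
    [AddMonoid.FG M] (f g : M →+ (κ → ℕ)) : IsSemilinearSet {x | toLex (f x) < toLex (g x)} := by
  let eval : κ → (κ → ℕ) →+ ℕ := Pi.evalAddMonoidHom fun _ => ℕ
  have hlex : {x | toLex (f x) < toLex (g x)} =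
      ⋃ i, (⋂ j : Set.Iio i, {x | (eval j).comp f x = (eval j).comp g x}) ∩
        {x | (eval i).comp f x < (eval i).comp g x} := by
    ext x
    simp only [Set.mem_iUnion, Set.mem_inter_iff, Set.mem_iInter, Subtype.forall]
    rfl
  rw [hlex]
  exact .iUnion fun i => .inter (.iInter fun j => isSemilinearSet_setOf_eq _ _)
    (isSemilinearSet_setOf_lt _ _)

theorem exists_isWellOrder_isSemilinearSet [Finite κ] (w : (κ → ℕ) →+ ℕ) :
    ∃ r : (κ → ℕ) → (κ → ℕ) → Prop, IsWellOrder (κ → ℕ) r ∧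
      IsSemilinearSet {z : (κ → ℕ) × (κ → ℕ) | r z.1 z.2} ∧ ∀ x y, ¬ r y x → w x ≤ w y := by
  obtain ⟨_, _⟩ := exists_wellFoundedLT κ
  let key (x : κ → ℕ) : ℕ ×ₗ Lex (κ → ℕ) := toLex (w x, toLex x)
  have hkey : Function.Injective key := fun x y h => toLex_inj.1 (congrArg (fun z => (ofLex z).2) h)
  refine ⟨key ⁻¹'o (· < ·), (RelEmbedding.preimage ⟨key, hkey⟩ (· < ·)).isWellOrder, ?_, ?_⟩
  · let x : (κ → ℕ) × (κ → ℕ) →+ (κ → ℕ) := .fst _ _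
    let y : (κ → ℕ) × (κ → ℕ) →+ (κ → ℕ) := .snd _ _
    have hsplit : {z : (κ → ℕ) × (κ → ℕ) | key z.1 < key z.2} =
        {z | w.comp x z < w.comp y z} ∪
          ({z | w.comp x z = w.comp y z} ∩ {z | toLex (x z) < toLex (y z)}) :=
      Set.ext fun z => Prod.Lex.toLex_lt_toLex
    change IsSemilinearSet {z : (κ → ℕ) × (κ → ℕ) | key z.1 < key z.2}
    rw [hsplit]
    exact (isSemilinearSet_setOf_lt _ _).union
      ((isSemilinearSet_setOf_eq _ _).inter (isSemilinearSet_setOf_toLex_lt _ _))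
  · intro x y hyx
    exact (Prod.Lex.monotone_fst _ _ (not_lt.1 hyx) :)

theorem exists_rightInverse_isSemilinearSet_range [Finite κ] {W C : Type*} {φ : W → κ → ℕ}
    {cls : W → C} (hsurj : Function.Surjective cls) (hφ : ∀ u v, φ u = φ v → cls u = cls v)
    (hcls : IsSemilinearSet {z | ∃ u v, cls u = cls v ∧ (φ u, φ v) = z})
    {r : (κ → ℕ) → (κ → ℕ) → Prop} [IsWellOrder (κ → ℕ) r]
    (hr : IsSemilinearSet {z : (κ → ℕ) × (κ → ℕ) | r z.1 z.2}) :
    ∃ rep : C → W, Function.RightInverse rep cls ∧ (∀ u, ¬ r (φ u) (φ (rep (cls u)))) ∧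
      IsSemilinearSet (Set.range (φ ∘ rep)) := by
  have hmin (c : C) : ∃ u, cls u = c ∧ ∀ v, cls v = c → ¬ r (φ v) (φ u) := by
    obtain ⟨u, hu, hmin⟩ :=
      (InvImage.wf φ (IsWellFounded.wf (r := r))).has_min {u | cls u = c} (hsurj c)
    exact ⟨u, hu, fun v hv => hmin v hv⟩
  choose rep hrep hmin using hmin
  refine ⟨rep, hrep, fun u => hmin _ u rfl, ?_⟩
  let E : Set ((κ → ℕ) × (κ → ℕ)) := {z | ∃ u v, cls u = cls v ∧ (φ u, φ v) = z}
  have hrange : Set.range (φ ∘ rep) =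
      Prod.snd '' E \ Prod.snd '' (E ∩ {z : (κ → ℕ) × (κ → ℕ) | r z.1 z.2}) := by
    ext x
    constructor
    · rintro ⟨c, rfl⟩
      refine ⟨⟨_, ⟨rep c, rep c, rfl, rfl⟩, rfl⟩, ?_⟩
      rintro ⟨_, ⟨⟨u, v, huv, rfl⟩, hruv⟩, hv : φ v = φ (rep c)⟩
      exact hmin c u (by rw [huv, hφ _ _ hv, hrep]) (hv ▸ hruv)
    · rintro ⟨⟨_, ⟨_, u, _, rfl⟩, rfl⟩, hu⟩
      have hru : ¬ r (φ (rep (cls u))) (φ u) := fun h =>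
        hu ⟨_, ⟨⟨rep (cls u), u, hrep _, rfl⟩, h⟩, rfl⟩
      exact ⟨cls u, (trichotomous_of r _ _).resolve_left hru
        |>.resolve_right (hmin _ u rfl)⟩
  rw [hrange]
  exact (hcls.image (AddMonoidHom.snd _ _)).sdiff ((hcls.inter hr).image (AddMonoidHom.snd _ _))

theorem isRationalSeries_countSeries_of_isSemilinearSet_setOf_eq [Finite κ] {W C : Type*}
    {φ : W → κ → ℕ} {cls : W → C} (hφ : ∀ u v, φ u = φ v → cls u = cls v)
    (hcls : IsSemilinearSet {z | ∃ u v, cls u = cls v ∧ (φ u, φ v) = z}) {w : (κ → ℕ) →+ ℕ}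
    {ν : C → ℕ} (hle : ∀ u, ν (cls u) ≤ w (φ u)) (hattain : ∀ c, ∃ u, cls u = c ∧ w (φ u) = ν c)
    (hfin : HasFiniteFibers ν Set.univ) : IsRationalSeries (countSeries ν Set.univ) := by
  obtain ⟨r, _, hr, hrw⟩ := exists_isWellOrder_isSemilinearSet w
  have hsurj : Function.Surjective cls := fun c => (hattain c).imp fun _ hu => hu.1
  obtain ⟨rep, hrep, hmin, hrange⟩ := exists_rightInverse_isSemilinearSet_range hsurj hφ hcls hr
  have hinj : Function.Injective (φ ∘ rep) := fun c c' h => by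
    rw [← hrep c, ← hrep c', hφ _ _ h]
  have hw : w ∘ (φ ∘ rep) = ν := by
    ext c
    obtain ⟨u, rfl, hu⟩ := hattain c
    exact le_antisymm ((hrw _ _ (hmin u)).trans_eq hu)
      ((congrArg ν (hrep _)).symm.trans_le (hle _))
  rw [← hw, ← countSeries_image hinj.injOn, Set.image_univ]
  rw [← hw, ← hasFiniteFibers_image hinj.injOn, Set.image_univ] at hfin
  exact isRationalSeries_countSeries_of_isSemilinearSet hrange hfin

end MinimalRepresentatives

section Paths

open Pointwise

variable {M Q S : Type*} [AddCommMonoid M]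

/-- The labels of the paths in a labelled graph with all interior vertices in `K`. The label of a
path is the sum of the labels of its edges, and `d p q` is the set of labels of the edges from `p`
to `q`. -/
inductive PathLabel (d : Q → Q → Set M) (K : Set Q) : Q → Q → M → Prop
  | nil (p : Q) : PathLabel d K p p 0
  | single {p q : Q} {e : M} (he : e ∈ d p q) : PathLabel d K p q e
  | cons {p q r : Q} {e m : M} (he : e ∈ d p q) (hq : q ∈ K) (hm : PathLabel d K q r m) :
      PathLabel d K p r (e + m)

variable {d : Q → Q → Set M} {K : Set Q}

theorem PathLabel.mono {K' : Set Q} (hK : K ⊆ K') {p q : Q} {m : M} (h : PathLabel d K p q m) :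
    PathLabel d K' p q m := by
  induction h with
  | nil p => exact .nil p
  | single he => exact .single he
  | cons he hq _ ih => exact .cons he (hK hq) ih

theorem PathLabel.append {p k q : Q} {m m' : M} (h : PathLabel d K p k m) (hk : k ∈ K)
    (h' : PathLabel d K k q m') : PathLabel d K p q (m + m') := by
  induction h with
  | nil => rwa [zero_add]
  | single he => exact .cons he hk h'
  | cons he hq _ ih => rw [add_assoc]; exact .cons he hq (ih hk h')

theorem PathLabel.closure_append {k q : Q} (hk : k ∈ K) {z : M}
    (hz : z ∈ AddSubmonoid.closure {m | PathLabel d K k k m}) {m : M}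
    (h : PathLabel d K k q m) : PathLabel d K k q (z + m) := by
  induction hz using AddSubmonoid.closure_induction generalizing m with
  | mem x hx => exact hx.append hk h
  | zero => rwa [zero_add]
  | add x y _ _ ihx ihy => rw [add_assoc]; exact ihx (ihy h)

theorem setOf_pathLabel_empty (p q : Q) :
    {m | PathLabel d ∅ p q m} = d p q ∪ {m | p = q ∧ m = 0} := by
  ext m
  constructor
  · rintro (_ | he | ⟨-, hq, -⟩)
    exacts [.inr ⟨rfl, rfl⟩, .inl he, hq.elim]
  · rintro (he | ⟨rfl, rfl⟩)
    exacts [.single he, .nil p]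

/-- A path through `insert k K` is cut at its visits to `k`. -/
theorem setOf_pathLabel_insert (k p q : Q) :
    {m | PathLabel d (insert k K) p q m} = {m | PathLabel d K p q m} ∪
      ({m | PathLabel d K p k m} + ((AddSubmonoid.closure {m | PathLabel d K k k m} : Set M) +
        {m | PathLabel d K k q m})) := by
  have hsub : K ⊆ insert k K := Set.subset_insert k K
  have hk : k ∈ insert k K := Set.mem_insert k K
  ext m
  constructor
  · intro h
    induction h with
    | nil p => exact .inl (.nil p)
    | single he => exact .inl (.single he)
    | @cons p j q e m he hj _ ih =>
      obtain rfl | hjK := hj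
      · right
        obtain h | ⟨a, ha, _, ⟨z, hz, b, hb, rfl⟩, rfl⟩ := ih
        · exact ⟨e, .single he, m, ⟨0, zero_mem _, m, h, zero_add m⟩, rfl⟩
        · exact ⟨e, .single he, a + z + b,
            ⟨a + z, add_mem (AddSubmonoid.subset_closure ha) hz, b, hb, rfl⟩,
            congrArg (e + ·) (add_assoc a z b)⟩
      · obtain h | ⟨a, ha, b, hb, rfl⟩ := ih
        · exact .inl (.cons he hjK h)
        · exact .inr ⟨e + a, .cons he hjK ha, b, hb, add_assoc e a b⟩
  · rintro (h | ⟨a, ha, _, ⟨z, hz, b, hb, rfl⟩, rfl⟩)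
    · exact h.mono hsub
    · exact (ha.mono hsub).append hk <| .closure_append hk
        (AddSubmonoid.closure_mono (fun _ => PathLabel.mono hsub) hz) (hb.mono hsub)

/-- Kleene's theorem, with labels in a commutative monoid. -/
theorem isSemilinearSet_setOf_pathLabel (hd : ∀ p q, IsSemilinearSet (d p q)) (hK : K.Finite)
    (p q : Q) : IsSemilinearSet {m | PathLabel d K p q m} := by
  induction K, hK using Set.Finite.induction_on generalizing p q with
  | empty =>
    rw [setOf_pathLabel_empty]
    exact (hd p q).union (.of_finite ((Set.finite_singleton 0).subset fun _ h => h.2))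
  | insert _ _ ih =>
    rw [setOf_pathLabel_insert]
    exact (ih p _).union ((ih p _).add ((ih _ _).closure.add (ih _ q)))

/-- The sum of the values `v p s` over the transitions of the run of the deterministic automaton
with transition function `step` on a word. -/
def runSum (step : Q → S → Q) (v : Q → S → M) : Q → List S → M
  | _, [] => 0
  | p, s :: u => v p s + runSum step v (step p s) u

variable {step : Q → S → Q} {v : Q → S → M}

theorem map_runSum {N : Type*} [AddCommMonoid N] (f : M →+ N) (p : Q) (u : List S) :
    f (runSum step v p u) = runSum step (fun p s => f (v p s)) p u := by
  induction u generalizing p with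
  | nil => exact map_zero f
  | cons s u ih => rw [runSum, runSum, map_add, ih]

theorem pathLabel_univ_iff_exists_runSum {p q : Q} {m : M} :
    PathLabel (fun p q => {m | ∃ s, step p s = q ∧ v p s = m}) Set.univ p q m ↔
      ∃ u : List S, u.foldl step p = q ∧ runSum step v p u = m := by
  constructor
  · intro h
    induction h with
    | nil p => exact ⟨[], rfl, rfl⟩
    | single he =>
      obtain ⟨s, rfl, rfl⟩ := he
      exact ⟨[s], rfl, add_zero _⟩
    | cons he _ _ ih =>
      obtain ⟨s, rfl, rfl⟩ := he
      obtain ⟨u, rfl, rfl⟩ := ih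
      exact ⟨s :: u, rfl, rfl⟩
  · rintro ⟨u, rfl, rfl⟩
    induction u generalizing p with
    | nil => exact .nil p
    | cons s u ih => exact .cons ⟨s, rfl, rfl⟩ trivial ih

theorem isSemilinearSet_setOf_runSum [Finite Q] [Finite S] (step : Q → S → Q) (v : Q → S → M)
    (p q : Q) : IsSemilinearSet {m | ∃ u : List S, u.foldl step p = q ∧ runSum step v p u = m} := by
  simp only [← pathLabel_univ_iff_exists_runSum]
  refine isSemilinearSet_setOf_pathLabel (fun p q => .of_finite ?_) Set.finite_univ p q
  exact (Set.finite_range (v p)).subset fun m ⟨s, _, hm⟩ => ⟨s, hm⟩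

end Paths

section EdgeCount

variable {Q S : Type*} [DecidableEq Q]

theorem runSum_single_sub_single (step : Q → S → Q) (p : Q) (u : List S) :
    runSum step (fun p s => Pi.single (step p s) 1 - Pi.single p 1 : Q → S → Q → ℤ) p u =
      Pi.single (u.foldl step p) 1 - Pi.single p 1 := by
  induction u generalizing p with
  | nil => simp [runSum]
  | cons s u ih =>
    rw [runSum, ih, List.foldl_cons]
    abel

variable [DecidableEq S]

/-- The number of times that the run of an automaton on a word uses each transition. -/
def edgeCount (step : Q → S → Q) : Q → List S → Q × S → ℕ :=
  runSum step fun p s => Pi.single (p, s) 1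

/-- The linear extension of a function on the transitions of an automaton to edge counts. -/
noncomputable def edgeSum [Fintype Q] [Fintype S] {M : Type*} [AddCommMonoid M] (v : Q → S → M) :
    (Q × S → ℕ) →+ M :=
  (Fintype.linearCombination ℕ fun e : Q × S => v e.1 e.2).toAddMonoidHom

theorem edgeSum_edgeCount [Fintype Q] [Fintype S] {M : Type*} [AddCommMonoid M]
    (step : Q → S → Q) (v : Q → S → M) (p : Q) (u : List S) :
    edgeSum v (edgeCount step p u) = runSum step v p u := by
  rw [edgeCount, map_runSum]
  simp [edgeSum, Fintype.linearCombination_apply_single]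

/-- The divergence of the flow along the edges of a path is supported on the end points. -/
theorem foldl_eq_of_edgeCount_eq [Finite Q] [Finite S] {step : Q → S → Q} {p : Q} {u u' : List S}
    (h : edgeCount step p u = edgeCount step p u') : u.foldl step p = u'.foldl step p := by
  have := Fintype.ofFinite Q
  have := Fintype.ofFinite S
  have hdiv := congrArg (edgeSum fun p s =>
    (Pi.single (step p s) 1 - Pi.single p 1 : Q → ℤ)) h
  simp only [edgeSum_edgeCount, runSum_single_sub_single, sub_left_inj] at hdiv
  by_contra hne
  simpa [hne] using congrFun hdiv (u.foldl step p)

end EdgeCount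

section CosetAutomaton

variable {G : Type*} [Group G] {A : Subgroup G} [A.Normal]

/-- A transversal of the cosets of a normal subgroup that represents `A` itself by `1`. -/
noncomputable def cosetRep (q : G ⧸ A) : G := q.out * (1 : G ⧸ A).out⁻¹

@[simp]
theorem mk_cosetRep (q : G ⧸ A) : ((cosetRep q : G) : G ⧸ A) = q := by
  simp [cosetRep]

theorem cosetRep_one : cosetRep (1 : G ⧸ A) = 1 := mul_inv_cancel _

theorem exists_toMul_mul_cosetRep (g : G) :
    ∃ a : Additive A, g = a.toMul * cosetRep (g : G ⧸ A) := by
  refine ⟨.ofMul ⟨g * (cosetRep (g : G ⧸ A))⁻¹, ?_⟩, by simp⟩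
  rw [← QuotientGroup.eq_one_iff]
  simp

variable {S : Finset G}

/-- The action of a letter on the cosets. -/
def cosetStep (q : G ⧸ A) (s : S) : G ⧸ A := q * (s : G)

/-- The Schreier generator `cosetRep p * s * (cosetRep (p * s))⁻¹`, written additively. -/
noncomputable def schreierGen (p : G ⧸ A) (s : S) : Additive A :=
  .ofMul ⟨cosetRep p * s * (cosetRep (cosetStep p s))⁻¹, by
    rw [← QuotientGroup.eq_one_iff]
    simp [cosetStep]⟩

theorem cosetRep_mul_eq_schreierGen_mul (p : G ⧸ A) (s : S) :
    cosetRep p * s = (schreierGen p s).toMul * cosetRep (cosetStep p s) :=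
  (inv_mul_cancel_right _ _).symm

theorem runSum_eq_wordWeight (ω : S → ℕ) (p : G ⧸ A) (u : List S) :
    runSum cosetStep (fun _ s => ω s) p u = wordWeight ω u := by
  induction u generalizing p with
  | nil => rfl
  | cons s u ih => rw [runSum, ih, wordWeight, wordWeight, List.map_cons, List.sum_cons]

open scoped IsMulCommutative in
theorem cosetRep_mul_wordEval [IsMulCommutative A] (p : G ⧸ A) (u : List S) :
    cosetRep p * wordEval u =
      (runSum cosetStep schreierGen p u).toMul * cosetRep (u.foldl cosetStep p) := by
  induction u generalizing p with
  | nil => simp [wordEval, runSum]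
  | cons s u ih =>
    have hcons : wordEval (s :: u) = s * wordEval u := by simp [wordEval]
    rw [hcons, ← mul_assoc, cosetRep_mul_eq_schreierGen_mul, mul_assoc, ih, ← mul_assoc, runSum,
      toMul_add, Subgroup.coe_mul, List.foldl_cons]

end CosetAutomaton

section Conjugation

open scoped IsMulCommutative

variable {G : Type*} [Group G] {A : Subgroup G} [A.Normal]

/-- Conjugation by an element of the group, as an endomorphism of a normal subgroup. -/
def conjAddHom (g : G) : Additive A →+ Additive A :=
  MonoidHom.toAdditive (MulAut.conjNormal g : A ≃* A).toMonoidHom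

theorem coe_toMul_conjAddHom (g : G) (a : Additive A) :
    ((conjAddHom g a).toMul : G) = g * a.toMul * g⁻¹ :=
  MulAut.conjNormal_apply g a.toMul

theorem mul_conj_eq_toMul_mul (a b : Additive A) (u t : G) :
    (b.toMul * u) * (a.toMul * t) * (b.toMul * u)⁻¹ =
      (b + conjAddHom u a - conjAddHom (u * t * u⁻¹) b).toMul * (u * t * u⁻¹) := by
  simp only [sub_eq_add_neg, toMul_neg, toMul_add, Subgroup.coe_inv, Subgroup.coe_mul,
    coe_toMul_conjAddHom]
  group

variable [IsMulCommutative A]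

theorem isSemilinearSet_setOf_exists_conj_eq {N : Type*} [AddCommMonoid N] [AddMonoid.FG N]
    (α α' : N →+ Additive A) (u t t' : G) :
    IsSemilinearSet {z | ∃ b : Additive A,
      (b.toMul * u) * ((α z).toMul * t) * (b.toMul * u)⁻¹ = (α' z).toMul * t'} := by
  simp only [mul_conj_eq_toMul_mul]
  generalize u * t * u⁻¹ = s
  by_cases hst : ∃ a : Additive A, s = a.toMul * t'
  · obtain ⟨a, rfl⟩ := hst
    -- Modulo the image of `1 - σ` the unknown `b` disappears, leaving a linear equation in `z`.
    generalize conjAddHom (A := A) (a.toMul * t') = σ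
    let δ : Additive A →+ Additive A := AddMonoidHom.id _ - σ
    let π := QuotientAddGroup.mk' δ.range
    have hset : {z | ∃ b, ((b + conjAddHom u (α z) - σ b).toMul : G) * (a.toMul * t') =
        (α' z).toMul * t'} =
          {z | π a + (π.comp ((conjAddHom u).comp α)) z = 0 + (π.comp α') z} := by
      ext z
      have hquot : π a + (π.comp ((conjAddHom u).comp α)) z = 0 + (π.comp α') z ↔
          -(a + conjAddHom u (α z)) + α' z ∈ δ.range := by
        rw [← QuotientAddGroup.eq, zero_add]
        rfl
      rw [Set.mem_ofPred_eq, Set.mem_ofPred_eq, hquot]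
      refine exists_congr fun b => ?_
      rw [← mul_assoc, mul_left_inj, ← Subgroup.coe_mul, ← toMul_add, Subtype.val_inj,
        Additive.toMul.injective.eq_iff, eq_neg_add_iff_add_eq]
      refine Eq.congr_left ?_
      simp only [δ, AddMonoidHom.sub_apply, AddMonoidHom.id_apply]
      abel
    rw [hset]
    exact isSemilinearSet_setOfPred_eq _ _ _ _
  · convert IsSemilinearSet.empty
    refine Set.eq_empty_of_forall_notMem fun z ⟨b, hb⟩ =>
      hst ⟨-(b + conjAddHom u (α z) - conjAddHom s b) + α' z, ?_⟩
    rw [toMul_add, toMul_neg, Subgroup.coe_mul, Subgroup.coe_inv, mul_assoc, ← hb,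
      inv_mul_cancel_left]

theorem isSemilinearSet_setOf_isConj [A.FiniteIndex] {N : Type*} [AddCommMonoid N]
    [AddMonoid.FG N] (α α' : N →+ Additive A) (t t' : G) :
    IsSemilinearSet {z | IsConj ((α z).toMul * t) ((α' z).toMul * t')} := by
  have hset : {z | IsConj ((α z).toMul * t) ((α' z).toMul * t')} = ⋃ q : G ⧸ A,
      {z | ∃ b : Additive A, (b.toMul * cosetRep q) * ((α z).toMul * t) *
        (b.toMul * cosetRep q)⁻¹ = (α' z).toMul * t'} := by
    ext z
    simp only [Set.mem_iUnion, isConj_iff]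
    constructor
    · rintro ⟨c, hc⟩
      obtain ⟨b, hb⟩ := exists_toMul_mul_cosetRep (A := A) c
      exact ⟨c, b, by rwa [← hb]⟩
    · rintro ⟨q, b, hb⟩
      exact ⟨_, hb⟩
  rw [hset]
  exact .iUnion fun q => isSemilinearSet_setOf_exists_conj_eq α α' _ t t'

end Conjugation

section ConjugacyGrowth

open scoped IsMulCommutative

variable {G : Type*} [Group G] {S : Finset G}

theorem classWeight_mk_wordEval_le (ω : S → ℕ) (u : List S) :
    classWeight ω (ConjClasses.mk (wordEval u)) ≤ wordWeight ω u :=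
  le_trans (Nat.sInf_le ⟨_, ConjClasses.mem_carrier_mk, rfl⟩) (Nat.sInf_le ⟨u, rfl, rfl⟩)

variable {A : Subgroup G} [A.Normal] [IsMulCommutative A] [A.FiniteIndex]

open Classical in
theorem exists_wordEval_eq_edgeCount : ∃ α : ((G ⧸ A) × S → ℕ) →+ Additive A, ∀ u : List S,
    wordEval u =
      (α (edgeCount cosetStep 1 u)).toMul * cosetRep (u.foldl cosetStep (1 : G ⧸ A)) := by
  have := Fintype.ofFinite (G ⧸ A)
  refine ⟨edgeSum schreierGen, fun u => ?_⟩
  rw [edgeSum_edgeCount, ← cosetRep_mul_wordEval, cosetRep_one, one_mul]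

open Classical in
theorem isSemilinearSet_setOf_mk_wordEval_eq :
    IsSemilinearSet {z : ((G ⧸ A) × S → ℕ) × ((G ⧸ A) × S → ℕ) | ∃ u v : List S,
      ConjClasses.mk (wordEval u) = ConjClasses.mk (wordEval v) ∧
        (edgeCount cosetStep 1 u, edgeCount cosetStep 1 v) = z} := by
  obtain ⟨α, hα⟩ := exists_wordEval_eq_edgeCount (A := A) (S := S)
  let x : ((G ⧸ A) × S → ℕ) × ((G ⧸ A) × S → ℕ) →+ ((G ⧸ A) × S → ℕ) := .fst _ _
  let y : ((G ⧸ A) × S → ℕ) × ((G ⧸ A) × S → ℕ) →+ ((G ⧸ A) × S → ℕ) := .snd _ _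
  let Y (q : G ⧸ A) : Set ((G ⧸ A) × S → ℕ) :=
    {m | ∃ u : List S, u.foldl cosetStep 1 = q ∧ edgeCount cosetStep 1 u = m}
  have hY (q : G ⧸ A) : IsSemilinearSet (Y q) := isSemilinearSet_setOf_runSum _ _ _ _
  have hset : {z : ((G ⧸ A) × S → ℕ) × ((G ⧸ A) × S → ℕ) | ∃ u v : List S,
      ConjClasses.mk (wordEval u) = ConjClasses.mk (wordEval v) ∧
        (edgeCount cosetStep 1 u, edgeCount cosetStep 1 v) = z} =
      ⋃ q, ⋃ q', x ⁻¹' Y q ∩ (y ⁻¹' Y q' ∩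
        {z | IsConj ((α.comp x z).toMul * cosetRep q) ((α.comp y z).toMul * cosetRep q')}) := by
    ext z
    simp only [Set.mem_iUnion, ConjClasses.mk_eq_mk_iff_isConj]
    constructor
    · rintro ⟨u, v, huv, rfl⟩
      rw [hα, hα] at huv
      exact ⟨_, _, ⟨u, rfl, rfl⟩, ⟨v, rfl, rfl⟩, huv⟩
    · rintro ⟨_, _, ⟨u, rfl, hu⟩, ⟨v, rfl, hv⟩, huv⟩
      refine ⟨u, v, ?_, Prod.ext hu hv⟩
      rwa [hα, hα, hu, hv]
  rw [hset]
  exact .iUnion fun q => .iUnion fun q' => ((hY q).preimage x).inter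
    (((hY q').preimage y).inter (isSemilinearSet_setOf_isConj _ _ _ _))

end ConjugacyGrowth

theorem isRationalSeries_conjGrowthSeries_of_normal {G : Type*} [Group G] {S : Finset G}
    (A : Subgroup G) [A.Normal] [IsMulCommutative A] [A.FiniteIndex]
    (hS : Submonoid.closure (S : Set G) = ⊤) {ω : S → ℕ} (hω : ∀ s, 0 < ω s) :
    IsRationalSeries (conjGrowthSeries ω) := by
  classical
  have := Fintype.ofFinite (G ⧸ A)
  have hseries : conjGrowthSeries ω = countSeries (classWeight ω) Set.univ := by
    ext n
    simp only [conjGrowthSeries, conjGrowth, countSeries, Set.univ_inter]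
    rfl
  have hcls (u v : List S) (huv : edgeCount (cosetStep (A := A)) 1 u = edgeCount cosetStep 1 v) :
      ConjClasses.mk (wordEval u) = ConjClasses.mk (wordEval v) := by
    obtain ⟨α, hα⟩ := exists_wordEval_eq_edgeCount (A := A) (S := S)
    rw [hα, hα, huv, foldl_eq_of_edgeCount_eq huv]
  have hweight (u : List S) : edgeSum (fun _ : G ⧸ A => ω) (edgeCount cosetStep 1 u) =
      wordWeight ω u := by
    rw [edgeSum_edgeCount, runSum_eq_wordWeight]
  rw [hseries]
  refine isRationalSeries_countSeries_of_isSemilinearSet_setOf_eq hcls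
    isSemilinearSet_setOf_mk_wordEval_eq (w := edgeSum fun _ => ω) (fun u => ?_) (fun c => ?_)
    fun n => ?_
  · exact (classWeight_mk_wordEval_le ω u).trans_eq (hweight u).symm
  · simpa only [hweight] using exists_word_classWeight hS ω c
  · exact (finite_classWeight_eq hS ω hω n).subset fun c hc => hc.2

end WeightedGrowth

theorem theoremC {G : Type*} [Group G] (hG : IsVirtuallyAbelian G)
    (S : Finset G) (hS : Submonoid.closure (S : Set G) = ⊤)
    (ω : S → ℕ) (hω : ∀ s : S, 0 < ω s) :
    WeightedGrowth.IsRationalSeries (WeightedGrowth.conjGrowthSeries ω) := by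
  obtain ⟨H, hH, hfin⟩ := hG
  have : IsMulCommutative H.normalCore := .of_setLike_mul_comm fun a ha b hb =>
    setLike_mul_comm (H.normalCore_le ha) (H.normalCore_le hb)
  exact WeightedGrowth.isRationalSeries_conjGrowthSeries_of_normal H.normalCore hS hω
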